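/- For $x\in\mathbb{C}$, $k\in\mathbb{N}=\{0,1,2,\dots\}$ let $(x)_k=x(x+1)\cdots(x+k-1)$, and for a finite vector $\mathbf{x}=(x_1,\dots,x_p)$ put $(\mathbf{x})_k=(x_1)_k\cdots(x_p)_k$. Write $$F\!\left(\begin{matrix}\mathbf{a}\\ \mathbf{b}\end{matrix}\right)=\sum_{k=0}^{\infty}\frac{(\mathbf{a})_k}{(\mathbf{b})_k\,k!}$$ for the generalized hypergeometric function at unit argument. If $\mathbf a$ contains $-N$ with $N\in\mathbb N$, the series terminates: the sum is over $0\le k\le N$. The function is called Saalschützian if $\mathbf{a}$ has one entry more than $\mathbf{b}$ and its parametric excess (the sum of the entries of $\mathbf{b}$ minus the sum of the entries of $\mathbf{a}$) equals $1$. Let $r\in\mathbb{N}$, $\mathbf{f}=(f_1,\dots,f_r)\in\mathbb{C}^r$, $\mathbf{m}=(m_1,\dots,m_r)\in\mathbb{N}^r$, $m=m_1+\dots+m_r$, $a,b,c,d,e,g\in\mathbb{C}$, $\lambda=c-a-b-m$, $n\in\mathbb{N}$. Suppose that $(1+a+b-c)_m\ne0$, $(c-a-m)_m\ne0$, $(c-b-m)_m\ne0$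 and $g+e+n-d+\lambda=1$. Let $\hat{\boldsymbol\zeta}$ be the vector of zeros, listed with multiplicity, of the polynomial in $t$ of degree at most $m$ $$\hat{Q}_m(t)=\sum_{k=0}^{m}\frac{(a)_k(b)_k(t)_k}{(c-a-m)_k(c-b-m)_k\,k!}\,F\!\left(\begin{matrix}-k,\mathbf{f}+\mathbf{m}\\ \mathbf{f}\end{matrix}\right)F\!\left(\begin{matrix}-m+k,\ t+k,\ c-a-b-m\\ c-a-m+k,\ c-b-m+k\end{matrix}\right).$$ Assume that none of $c,g,e,g+\lambda,e+\lambda$, the $f_i$ and the entries of $\hat{\boldsymbol\zeta}$ is a non-positive integer. Then $$F\!\left(\begin{matrix}-n,a,b,d,\mathbf{f}+\mathbf{m}\\ c,g,e,\mathbf{f}\end{matrix}\right)=\frac{(g+\lambda)_n(e+\lambda)_n}{(g)_n(e)_n}\,F\!\left(\begin{matrix}-n,a+\lambda,b+\lambda,d,\hat{\boldsymbol\zeta}+1\\ c,g+\lambda,e+\lambda,\hat{\boldsymbol\zeta}\end{matrix}\right),$$ where $\mathbf{f}+\mathbf{m}$ is the entrywise sum and $\hat{\boldsymbol\zeta}+1$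 adds $1$ to every entry. The function on the left-hand side is Saalschützian, and so is the function on the right-hand side whenever $\hat{Q}_m$ has degree exactly $m$ (that is, $\hat{\boldsymbol\zeta}$ has $m$ entries). -/

import Mathlib

open Polynomial

noncomputable section

/-- The Pochhammer symbol (rising factorial) `(x)_k = x (x + 1) ⋯ (x + k - 1)`. -/
def poch (x : ℂ) (k : ℕ) : ℂ := (ascPochhammer ℂ k).eval x

/-- The product `(a₁)_k ⋯ (a_p)_k` over a vector of parameters (the order is irrelevant). -/
def pochs (A : Multiset ℂ) (k : ℕ) : ℂ := (A.map fun x => poch x k).prod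

/-- The generalized hypergeometric series with upper parameters `A` and lower parameters `B`
at the argument `x`. -/
def hyperF (A B : Multiset ℂ) (x : ℂ) : ℂ :=
  ∑' k : ℕ, pochs A k / (pochs B k * (k.factorial : ℂ)) * x ^ k

/-- The parametric excess: the sum of the lower minus the sum of the upper parameters. -/
def parametricExcess (A B : Multiset ℂ) : ℂ := B.sum - A.sum

/-- A hypergeometric function with `p + 1` upper and `p` lower parameters is Saalschützian
if its parametric excess equals one. -/
def IsSaalschutzian (A B : Multiset ℂ) : Prop :=
  Multiset.card A = Multiset.card B + 1 ∧ parametricExcess A B = 1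

/-- The multiset of the entries of a vector. -/
def entries {r : ℕ} (v : Fin r → ℂ) : Multiset ℂ := Finset.univ.val.map v

/-- The terminating `₃F₂(-N, t + k, u; v, w; 1)` as a polynomial in `t`. -/
def terminating3F2Poly (N k : ℕ) (u v w : ℂ) : ℂ[X] :=
  ∑ j ∈ Finset.range (N + 1),
    C (poch (-(N : ℂ)) j * poch u j / (poch v j * poch w j * (j.factorial : ℂ))) *
      (ascPochhammer ℂ j).comp (X + C (k : ℂ))

/-- The characteristic polynomial of the second Miller-Paris transformation; its values are
given by `eval_Qhat` below. -/
def Qhat (a b c : ℂ) {r : ℕ} (f : Fin r → ℂ) (m : Fin r → ℕ) : ℂ[X] :=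
  ∑ k ∈ Finset.range ((∑ i, m i) + 1),
    C (hyperF (-(k : ℂ) ::ₘ entries fun i => f i + m i) (entries f) 1 * poch a k * poch b k /
        (poch (c - a - (∑ i, m i : ℕ)) k * poch (c - b - (∑ i, m i : ℕ)) k *
          (k.factorial : ℂ))) *
      ascPochhammer ℂ k *
      terminating3F2Poly ((∑ i, m i) - k) k (c - a - b - (∑ i, m i : ℕ))
        (c - a - (∑ i, m i : ℕ) + k) (c - b - (∑ i, m i : ℕ) + k)

lemma poch_neg_eq_zero {N k : ℕ} (h : N < k) : poch (-(N : ℂ)) k = 0 := by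
  unfold poch
  rw [ascPochhammer_eval_neg_eq_descPochhammer]
  simp [descPochhammer_eval_coe_nat_of_lt h]

lemma eval_terminating3F2Poly (N k : ℕ) (u v w t : ℂ) :
    (terminating3F2Poly N k u v w).eval t = hyperF {-(N : ℂ), t + k, u} {v, w} 1 := by
  unfold terminating3F2Poly hyperF
  rw [tsum_eq_sum (s := Finset.range (N + 1)), eval_finsetSum]
  · refine Finset.sum_congr rfl fun j _ => ?_
    simp only [eval_mul, eval_C, eval_comp, eval_add, eval_X, pochs, poch, Multiset.map_cons,
      Multiset.insert_eq_cons, Multiset.map_singleton, Multiset.prod_cons,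
      Multiset.prod_singleton, one_pow, mul_one]
    ring
  · intro j hj
    have hj' : N < j := by simpa using hj
    simp [pochs, poch_neg_eq_zero hj']

/-- The defining formula of the characteristic polynomial. -/
lemma eval_Qhat (a b c : ℂ) {r : ℕ} (f : Fin r → ℂ) (m : Fin r → ℕ) (M : ℕ)
    (hM : M = ∑ i, m i) (t : ℂ) :
    (Qhat a b c f m).eval t =
      ∑ k ∈ Finset.range (M + 1),
        hyperF (-(k : ℂ) ::ₘ entries fun i => f i + m i) (entries f) 1 *
            poch a k * poch b k * poch t k /
          (poch (c - a - M) k * poch (c - b - M) k * (k.factorial : ℂ)) *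
        hyperF {-(M : ℂ) + k, t + k, c - a - b - M} {c - a - M + k, c - b - M + k} 1 := by
  subst hM
  unfold Qhat
  rw [eval_finsetSum]
  refine Finset.sum_congr rfl fun k hk => ?_
  have hk' : k ≤ ∑ i, m i := by simpa [Nat.lt_succ_iff] using hk
  rw [eval_mul, eval_mul, eval_C, eval_terminating3F2Poly, Nat.cast_sub hk', neg_sub,
    sub_eq_neg_add]
  simp only [poch]
  ring_nf

end

noncomputable section

open Finset

/-! Write `s = λ`. The core is an identity of formal power series (`mk_pochs_eq_binSeries_mul`): the
Gauss series with parameters `a, b; c` and the extra factor `(f+m)_k / (f)_k` equals `(1-x)^s` times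
the Gauss series with `a+s, b+s; c` and the extra factor `Qhat(-j)`. To get it, the extra factor is
a polynomial in `k` of degree at most `m`, so Newton interpolation expands it in the `(-k)_p`, `p ≤
m`. Each `(-k)_p` shifts the Gauss parameters by `p`, and Euler's transformation yields the exponent
`c-a-b-p = s+(m-p)`. The surplus `(1-x)^(m-p)` is absorbed by iterating a contiguous relation, which
produces the terminating `₃F₂` in `Qhat`. Then the functional `x^k ↦ (-n)_k (d)_k / ((g)_k (e)_k)`
is applied to both sides. By the balance condition its value on `x^j (1-x)^s` is a Saalschütz sum
(`sum_binSeries_mul_weight`). Finally `Qhat(0) = 1` turns `Qhat(-j)` into `(ζ+1)_j / (ζ)_j`. -/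

/-! ### Pochhammer symbols. -/

@[simp] lemma poch_zero (x : ℂ) : poch x 0 = 1 := by simp [poch]

lemma poch_succ (x : ℂ) (k : ℕ) : poch x (k + 1) = poch x k * (x + k) := by
  simp [poch, ascPochhammer_succ_eval]

lemma poch_add (x : ℂ) (k l : ℕ) : poch x (k + l) = poch x k * poch (x + k) l := by
  induction l with
  | zero => simp
  | succ l ih => rw [← add_assoc, poch_succ, poch_succ, ih]; push_cast; ring

lemma poch_succ_left (x : ℂ) (k : ℕ) : poch x (k + 1) = x * poch (x + 1) k := by
  rw [add_comm k 1, poch_add, poch_succ]; simp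

lemma poch_ne_zero {x : ℂ} (hx : ∀ k : ℕ, x ≠ -k) (k : ℕ) : poch x k ≠ 0 := by
  induction k with
  | zero => simp
  | succ k ih =>
    rw [poch_succ]
    exact mul_ne_zero ih fun h => hx k (eq_neg_of_add_eq_zero_left h)

lemma poch_ne_zero_of_le {x : ℂ} {k l : ℕ} (h : poch x l ≠ 0) (hkl : k ≤ l) : poch x k ≠ 0 := by
  obtain ⟨i, rfl⟩ := Nat.exists_eq_add_of_le hkl
  rw [poch_add] at h
  exact left_ne_zero_of_mul h

lemma poch_add_natCast_ne_zero {x : ℂ} (hx : ∀ k : ℕ, x ≠ -k) (i k : ℕ) :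
    poch (x + i) k ≠ 0 := by
  refine poch_ne_zero (fun l hl => hx (i + l) ?_) k
  push_cast
  linear_combination hl

/-- Reversal of the factors of a Pochhammer symbol. -/
lemma poch_neg (x : ℂ) (k : ℕ) : poch (1 - x - k) k = (-1) ^ k * poch x k := by
  induction k generalizing x with
  | zero => simp
  | succ k ih =>
    rw [poch_succ_left, poch_succ x]
    have := ih x
    rw [show (1 - x - ((k + 1 : ℕ) : ℂ) + 1) = 1 - x - k by push_cast; ring, this]
    push_cast
    ring

lemma poch_neg_natCast (j p : ℕ) :
    poch (-(j : ℂ)) p = (-1) ^ p * (p.factorial * j.choose p) := by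
  unfold poch
  rw [ascPochhammer_eval_neg_eq_descPochhammer, descPochhammer_eval_eq_descFactorial,
    Nat.descFactorial_eq_factorial_mul_choose]
  push_cast
  rfl

/-! ### The Pfaff-Saalschütz sum. -/

/-- The Pfaff-Saalschütz summation, with all denominators cleared. -/
theorem saalschutz (x y z : ℂ) (n : ℕ) :
    ∑ j ∈ range (n + 1), (n.choose j : ℂ) *
      (poch x j * poch y j * poch (z + j) (n - j) * poch (z - x - y) (n - j)) =
      poch (z - x) n * poch (z - y) n := by
  induction n with
  | zero => simp
  | succ n ih =>
    set w := z - x - y with hw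
    have key := Finset.sum_choose_succ_mul
      (fun j i => poch x j * poch y j * poch (z + j) i * poch w i) n
    rw [key, poch_succ, poch_succ, mul_mul_mul_comm, ← ih, sum_mul, ← sub_eq_zero,
      ← sum_add_distrib, ← sum_sub_distrib]
    -- Telescoping certificate for `S(n+1) = (z-x+n)(z-y+n) S(n)`. It vanishes at `j = 0` by the
    -- factor `j` and at `j = n+1` by the binomial, so the truncated `n - j` there is harmless.
    let L : ℕ → ℂ := fun j => (n.choose j : ℂ) * j *
      (poch x j * poch y j * poch w (n + 1 - j) * poch (z + j) (n - j))
    rw [sum_congr rfl (g := fun j => L (j + 1) - L j), sum_range_sub]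
    · simp [L]
    · intro j hj
      obtain ⟨i, rfl⟩ := Nat.exists_eq_add_of_le (Nat.lt_succ_iff.mp (mem_range.mp hj))
      simp only [L, show j + i + 1 - (j + 1) = i by lia, show j + i - (j + 1) = i - 1 by lia,
        show j + i + 1 - j = i + 1 by lia, show j + i - j = i by lia]
      rw [poch_succ x, poch_succ y, poch_succ w]
      rcases i with _ | i
      · simp [poch_succ]
        rw [hw]
        ring
      · have hch : (((j + (i + 1)).choose (j + 1) : ℕ) : ℂ) * (j + 1) =
            (j + (i + 1)).choose j * (i + 1) := by
          have := Nat.choose_succ_right_eq (j + (i + 1)) j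
          rw [show j + (i + 1) - j = i + 1 by lia] at this
          exact_mod_cast this
        have h1 : poch (z + j) (i + 1) = (z + j) * poch (z + j + 1) i := poch_succ_left _ _
        rw [show z + ((j + 1 : ℕ) : ℂ) = z + j + 1 by push_cast; ring, Nat.add_sub_cancel,
          poch_succ (z + j) (i + 1), poch_succ (z + j + 1) i, h1]
        push_cast
        rw [hw]
        linear_combination (-(poch x j * (x + j) * (poch y j * (y + j)) *
          poch (z - x - y) (i + 1) * poch (z + j + 1) i)) * hch

/-! ### Gauss series: Euler's transformation and contiguous relations. -/

/-- The Gauss hypergeometric function as a formal power series. -/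
def gaussSeries (u v w : ℂ) : PowerSeries ℂ :=
  PowerSeries.mk fun k => poch u k * poch v k / (poch w k * (k.factorial : ℂ))

/-- The power series of `(1 - x) ^ (-s)`. -/
def binSeries (s : ℂ) : PowerSeries ℂ :=
  PowerSeries.mk fun k => poch s k / (k.factorial : ℂ)

lemma coeff_gaussSeries (u v w : ℂ) (k : ℕ) : PowerSeries.coeff k (gaussSeries u v w) =
    poch u k * poch v k / (poch w k * (k.factorial : ℂ)) := by
  simp [gaussSeries]

lemma coeff_binSeries (s : ℂ) (k : ℕ) :
    PowerSeries.coeff k (binSeries s) = poch s k / (k.factorial : ℂ) := by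
  simp [binSeries]

/-- Euler's transformation of the Gauss hypergeometric series. -/
theorem gaussSeries_eq_binSeries_mul (u v w : ℂ) (hw : ∀ k : ℕ, w ≠ -k) :
    gaussSeries u v w = gaussSeries (w - u) (w - v) w * binSeries (u + v - w) := by
  ext n
  rw [PowerSeries.coeff_mul, coeff_gaussSeries, Finset.Nat.sum_antidiagonal_eq_sum_range_succ_mk]
  have hn : (n.factorial : ℂ) ≠ 0 := by exact_mod_cast n.factorial_ne_zero
  -- The coefficient of `x^n` in Euler's transformation is exactly this Saalschütz sum.
  have := saalschutz (w - u) (w - v) w n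
  rw [sub_sub_cancel, sub_sub_cancel, show u - (w - v) = u + v - w by ring] at this
  rw [← this, sum_div]
  refine sum_congr rfl fun j hj => ?_
  have hjn : j ≤ n := Nat.lt_succ_iff.mp (mem_range.mp hj)
  rw [coeff_gaussSeries, coeff_binSeries, Nat.cast_choose ℂ hjn]
  obtain ⟨i, rfl⟩ := Nat.exists_eq_add_of_le hjn
  simp only [Nat.add_sub_cancel_left]
  rw [poch_add w]
  have h1 := poch_ne_zero hw j
  have h2 := poch_add_natCast_ne_zero hw j i
  have h3 : (i.factorial : ℂ) ≠ 0 := by exact_mod_cast i.factorial_ne_zero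
  have h4 : (j.factorial : ℂ) ≠ 0 := by exact_mod_cast j.factorial_ne_zero
  field_simp

lemma binSeries_mul_one_sub_X_pow (s : ℂ) (N : ℕ) :
    binSeries (s + N) * (1 - PowerSeries.X) ^ N = binSeries s := by
  have step (s : ℂ) : binSeries (s + 1) * (1 - PowerSeries.X) = binSeries s := by
    ext k
    rw [mul_sub, mul_one, map_sub]
    rcases k with _ | k
    · simp [coeff_binSeries]
    · rw [PowerSeries.coeff_succ_mul_X, coeff_binSeries, coeff_binSeries, coeff_binSeries,
        poch_succ_left s, poch_succ, Nat.factorial_succ]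
      have h3 : (k.factorial : ℂ) ≠ 0 := by exact_mod_cast k.factorial_ne_zero
      have h4 : (k + 1 : ℂ) ≠ 0 := by exact_mod_cast k.succ_ne_zero
      push_cast
      field_simp
      ring
  induction N with
  | zero => simp
  | succ N ih =>
    rw [pow_succ', ← mul_assoc, ← ih]
    push_cast
    rw [← add_assoc, step]

lemma one_sub_X_mul_gaussSeries (u v w : ℂ) (hw : ∀ k : ℕ, w ≠ -k) :
    (1 - PowerSeries.X) * gaussSeries (u + 1) (v + 1) w =
      gaussSeries u v w + PowerSeries.C ((u + v + 1 - w) / w) *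
        (PowerSeries.X * gaussSeries (u + 1) (v + 1) (w + 1)) := by
  ext k
  rw [sub_mul, one_mul, map_sub, map_add, PowerSeries.coeff_C_mul]
  rcases k with _ | k
  · simp [coeff_gaussSeries]
  · rw [PowerSeries.coeff_succ_X_mul, PowerSeries.coeff_succ_X_mul]
    simp only [coeff_gaussSeries]
    have h0 : w ≠ 0 := by simpa using hw 0
    have h1 := poch_ne_zero hw k
    have h2 : poch (w + 1) k ≠ 0 := by simpa using poch_add_natCast_ne_zero hw 1 k
    have h5 : w + k ≠ 0 := fun h => hw k (eq_neg_of_add_eq_zero_left h)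
    have h3 : (k.factorial : ℂ) ≠ 0 := by exact_mod_cast k.factorial_ne_zero
    have h4 : (k + 1 : ℂ) ≠ 0 := by exact_mod_cast k.succ_ne_zero
    have h6 : poch w k = w * poch (w + 1) k / (w + k) := by
      rw [eq_div_iff h5, ← poch_succ, poch_succ_left]
    rw [poch_succ_left u, poch_succ_left v, poch_succ_left w, poch_succ (u + 1),
      poch_succ (v + 1), Nat.factorial_succ, h6]
    push_cast
    field_simp
    ring

/-- Iterating the one-step relation: each factor `1-x` either lowers both upper parameters or
contributes an `x` and raises the lower one, so a binomial sum arises. -/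
theorem one_sub_X_pow_mul_gaussSeries (N : ℕ) (u v w : ℂ) (hw : ∀ k : ℕ, w ≠ -k) :
    (1 - PowerSeries.X) ^ N * gaussSeries (u + N) (v + N) w =
      ∑ i ∈ range (N + 1), (N.choose i : ℂ) •
        (PowerSeries.C (poch (u + v + N - w) i / poch w i) *
          (PowerSeries.X ^ i * gaussSeries (u + i) (v + i) (w + i))) := by
  induction N generalizing u v w with
  | zero => simp
  | succ N ih =>
    have h0 : w ≠ 0 := by simpa using hw 0
    have hw1 : ∀ k : ℕ, w + 1 ≠ -k := fun k hk => hw (k + 1) (by push_cast; linear_combination hk)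
    have c := one_sub_X_mul_gaussSeries (u + N) (v + N) w hw
    have ih2 := ih (u + 1) (v + 1) (w + 1) hw1
    rw [show u + 1 + (N : ℂ) = u + N + 1 by ring, show v + 1 + (N : ℂ) = v + N + 1 by ring] at ih2
    push_cast
    rw [← add_assoc, ← add_assoc, pow_succ, mul_assoc, c, mul_add, ih u v w hw,
      mul_left_comm, mul_left_comm _ PowerSeries.X, ih2]
    have split (F : ℕ → PowerSeries ℂ) :
        ∑ i ∈ range (N + 1 + 1), ((N + 1).choose i : ℂ) • F i = F 0 + ∑ i ∈ range (N + 1),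
          ((N + 1).choose (i + 1) : ℂ) • F (i + 1) := by
      rw [sum_range_succ']; simp [add_comm]
    rw [split]
    rw [← add_zero (∑ i ∈ range (N + 1), (N.choose i : ℂ) • _)]
    -- A vanishing term of index `N+1` is appended so that both sums can be merged by a Pascal-type
    -- rule.
    have z : (0 : PowerSeries ℂ) = ((N.choose (N + 1) : ℕ) : ℂ) •
        (PowerSeries.C (poch (u + v + N - w) (N + 1) / poch w (N + 1)) *
          (PowerSeries.X ^ (N + 1) * gaussSeries (u + (N + 1 : ℕ)) (v + (N + 1 : ℕ))
            (w + (N + 1 : ℕ)))) := by simp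
    conv_lhs => rw [z]
    rw [← sum_range_succ (fun i => (N.choose i : ℂ) •
        (PowerSeries.C (poch (u + v + N - w) i / poch w i) *
          (PowerSeries.X ^ i * gaussSeries (u + i) (v + i) (w + i))))]
    rw [sum_range_succ', mul_sum, mul_sum, add_right_comm, ← sum_add_distrib, add_comm]
    congr 1
    · simp
    · refine sum_congr rfl fun i hi => ?_
      have hch : (((N).choose (i + 1) : ℕ) : ℂ) * (i + 1) = N.choose i * (N - i) := by
        have := Nat.choose_succ_right_eq N i
        have hiN : i ≤ N := Nat.lt_succ_iff.mp (mem_range.mp hi)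
        rw [← Nat.cast_sub hiN]
        exact_mod_cast this
      have e (t : ℂ) : t + 1 + (i : ℂ) = t + (i + 1 : ℕ) := by push_cast; ring
      simp only [e, PowerSeries.smul_eq_C_mul]
      set G := gaussSeries (u + (i + 1 : ℕ)) (v + (i + 1 : ℕ)) (w + (i + 1 : ℕ))
      have hC : (N.choose (i + 1) : ℂ) * (poch (u + v + N - w) (i + 1) / poch w (i + 1)) +
          (u + N + (v + N) + 1 - w) / w * ((N.choose i : ℂ) *
            (poch (u + 1 + (v + 1) + N - (w + 1)) i / poch (w + 1) i)) =
          ((N + 1).choose (i + 1) : ℂ) * (poch (u + v + (N + 1) - w) (i + 1) / poch w (i + 1)) := by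
        rw [poch_succ_left w, poch_succ_left (u + v + N - w), poch_succ (u + v + (N + 1) - w),
          show u + v + N - w + 1 = u + v + (N + 1) - w by ring,
          show u + 1 + (v + 1) + N - (w + 1) = u + v + (N + 1) - w by ring,
          Nat.choose_succ_succ]
        have h2 : poch (w + 1) i ≠ 0 := poch_ne_zero hw1 i
        push_cast
        field_simp
        linear_combination (-poch (u + v + (N + 1) - w) i) * hch
      have hC' := congrArg (PowerSeries.C (R := ℂ)) hC
      simp only [map_add, map_mul] at hC'
      linear_combination (PowerSeries.X ^ (i + 1) * G) * hC'

/-- Expansion of a Gauss series in contiguous series after the exponent in Euler's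
transformation has been lowered by `N`. -/
theorem gaussSeries_eq_binSeries_mul_sum (N : ℕ) (u v w s : ℂ) (hw : ∀ k : ℕ, w ≠ -k)
    (hs : s = w - u - v - N) :
    gaussSeries u v w = binSeries (-s) *
      ∑ i ∈ range (N + 1), (N.choose i : ℂ) • (PowerSeries.C (poch s i / poch w i) *
          (PowerSeries.X ^ i * gaussSeries (w - u - N + i) (w - v - N + i) (w + i))) := by
  have h := one_sub_X_pow_mul_gaussSeries N (w - u - N) (w - v - N) w hw
  rw [sub_add_cancel, sub_add_cancel,
    show w - u - N + (w - v - N) + N - w = s by rw [hs]; ring] at h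
  rw [← h, ← mul_assoc, show -s = u + v - w + N by rw [hs]; ring,
    binSeries_mul_one_sub_X_pow, mul_comm]
  exact gaussSeries_eq_binSeries_mul u v w hw

/-- Inserting `(-k)_p` in the general term acts as `(-x)^p (d/dx)^p`, which shifts all three Gauss
parameters by `p`. -/
lemma coeff_X_pow_mul_gaussSeries (u v w : ℂ) (hw : ∀ k : ℕ, w ≠ -k) (p k : ℕ) :
    PowerSeries.coeff k (PowerSeries.X ^ p * gaussSeries (u + p) (v + p) (w + p)) *
        ((-1) ^ p * poch u p * poch v p / poch w p) =
      poch u k * poch v k / (poch w k * (k.factorial : ℂ)) * poch (-(k : ℂ)) p := by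
  rw [PowerSeries.coeff_X_pow_mul', poch_neg_natCast]
  split_ifs with h
  · obtain ⟨i, rfl⟩ := Nat.exists_eq_add_of_le h
    rw [Nat.add_sub_cancel_left, coeff_gaussSeries, poch_add u, poch_add v, poch_add w,
      Nat.cast_add_choose]
    have h1 := poch_ne_zero hw p
    have h2 := poch_add_natCast_ne_zero hw p i
    have h3 : (i.factorial : ℂ) ≠ 0 := by exact_mod_cast i.factorial_ne_zero
    have h4 : (p.factorial : ℂ) ≠ 0 := by exact_mod_cast p.factorial_ne_zero
    have h5 : ((p + i).factorial : ℂ) ≠ 0 := by exact_mod_cast (p + i).factorial_ne_zero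
    field_simp
  · simp [Nat.choose_eq_zero_of_lt (not_le.mp h)]

lemma gaussSeries_comm (u v w : ℂ) : gaussSeries u v w = gaussSeries v u w := by
  ext k
  simp only [coeff_gaussSeries, mul_comm]

/-- The second Miller-Paris transformation for the numerator polynomial `(-k)_p`. -/
theorem mk_poch_neg_mul_gauss (a b c s : ℂ) (M p : ℕ) (hp : p ≤ M) (hc : ∀ k : ℕ, c ≠ -k)
    (hs : s = c - a - b - M) (h₂ : poch (c - a - M) M ≠ 0) (h₃ : poch (c - b - M) M ≠ 0) :
    PowerSeries.mk (fun k => poch a k * poch b k / (poch c k * (k.factorial : ℂ)) *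
        poch (-(k : ℂ)) p) =
      binSeries (-s) * PowerSeries.mk (fun j =>
        poch (a + s) j * poch (b + s) j / (poch c j * (j.factorial : ℂ)) *
        (poch a p * poch b p * poch (-(j : ℂ)) p / (poch (c - a - M) p * poch (c - b - M) p) *
          (terminating3F2Poly (M - p) p s (c - a - M + p) (c - b - M + p)).eval (-(j : ℂ)))) := by
  have hcp : ∀ k : ℕ, c + p ≠ -k := fun k hk => hc (p + k) (by push_cast; linear_combination hk)
  have hL : PowerSeries.mk (fun k => poch a k * poch b k / (poch c k * (k.factorial : ℂ)) *
        poch (-(k : ℂ)) p) = PowerSeries.C ((-1) ^ p * poch a p * poch b p / poch c p) *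
        (PowerSeries.X ^ p * gaussSeries (a + p) (b + p) (c + p)) := by
    ext k
    rw [PowerSeries.coeff_mk, PowerSeries.coeff_C_mul,
      ← coeff_X_pow_mul_gaussSeries a b c hc p k]
    ring
  rw [hL, gaussSeries_eq_binSeries_mul_sum (M - p) (a + p) (b + p) (c + p) s hcp
    (by rw [hs, Nat.cast_sub hp]; ring), mul_left_comm (PowerSeries.X ^ p), mul_left_comm]
  congr 1
  ext j
  rw [PowerSeries.coeff_C_mul, mul_sum, map_sum, mul_sum, PowerSeries.coeff_mk]
  unfold terminating3F2Poly
  rw [eval_finsetSum, mul_sum, mul_sum]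
  refine sum_congr rfl fun i hi => ?_
  have hiM : p + i ≤ M := by have := mem_range.mp hi; lia
  -- Here `c-b-M = a+s` and `c-a-M = b+s`. Splitting `(-j)_(p+i)` as `(-j)_p (-j+p)_i` separates the
  -- prefactor from the `i`-th term of the `₃F₂`.
  have hX := coeff_X_pow_mul_gaussSeries (c - b - M) (c - a - M) c hc (p + i) j
  have e1 (t : ℂ) : t + (p + i : ℕ) = t + p + i := by push_cast; ring
  rw [e1, e1, e1] at hX
  rw [show c + p - (a + p) - ((M - p : ℕ) : ℂ) + i = c - a - M + p + i by
      rw [Nat.cast_sub hp]; ring,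
    show c + p - (b + p) - ((M - p : ℕ) : ℂ) + i = c - b - M + p + i by
      rw [Nat.cast_sub hp]; ring,
    gaussSeries_comm,
    show PowerSeries.X ^ p * ((((M - p).choose i : ℕ) : ℂ) • (PowerSeries.C
        (poch s i / poch (c + p) i) * (PowerSeries.X ^ i *
          gaussSeries (c - b - M + p + i) (c - a - M + p + i) (c + p + i)))) =
      PowerSeries.C ((M - p).choose i * (poch s i / poch (c + p) i)) *
        (PowerSeries.X ^ (p + i) *
          gaussSeries (c - b - M + p + i) (c - a - M + p + i) (c + p + i)) by
      rw [PowerSeries.smul_eq_C_mul, map_mul, pow_add]; ring,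
    PowerSeries.coeff_C_mul, eval_mul, eval_C, eval_comp, eval_add, eval_X, eval_C,
    show (ascPochhammer ℂ i).eval (-(j : ℂ) + p) = poch (-(j : ℂ) + p) i from rfl,
    poch_neg_natCast (M - p),
    show a + s = c - b - M by rw [hs]; ring, show b + s = c - a - M by rw [hs]; ring]
  set T := PowerSeries.coeff j (PowerSeries.X ^ (p + i) *
          gaussSeries (c - b - M + p + i) (c - a - M + p + i) (c + p + i))
  rw [poch_add (-(j : ℂ)), poch_add c, poch_add (c - b - M), poch_add (c - a - M)] at hX
  have ha := poch_ne_zero_of_le h₂ hiM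
  have hb := poch_ne_zero_of_le h₃ hiM
  rw [poch_add] at ha hb
  have ha1 := left_ne_zero_of_mul ha
  have ha2 := right_ne_zero_of_mul ha
  have hb1 := left_ne_zero_of_mul hb
  have hb2 := right_ne_zero_of_mul hb
  have h1 := poch_ne_zero hc p
  have h2 := poch_ne_zero hcp i
  have h3 : (i.factorial : ℂ) ≠ 0 := by exact_mod_cast i.factorial_ne_zero
  have hsq : ((-1 : ℂ) ^ i) * (-1) ^ i = 1 := by rw [← mul_pow]; simp
  calc _ = (((-1 : ℂ) ^ i) * (-1) ^ i) * (poch a p * poch b p * (M - p).choose i * poch s i) /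
          (poch (c - b - M) p * poch (c - b - M + p) i *
            (poch (c - a - M) p * poch (c - a - M + p) i)) *
        (T * ((-1) ^ (p + i) * (poch (c - b - M) p * poch (c - b - M + p) i) *
          (poch (c - a - M) p * poch (c - a - M + p) i) / (poch c p * poch (c + p) i))) * (-1) ^ i := by
        rw [hsq, pow_add]
        field_simp
        linear_combination (-(T * (M - p).choose i * poch s i * poch a p * poch b p)) * hsq
    _ = _ := by
        rw [hX, hsq]
        field_simp


/-! ### Newton interpolation. -/

lemma sum_range_succ_congr_of_zero {F : ℕ → ℂ} {k M : ℕ} (h₁ : ∀ p, k < p → F p = 0)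
    (h₂ : ∀ p, M < p → F p = 0) : ∑ p ∈ range (k + 1), F p = ∑ p ∈ range (M + 1), F p := by
  rcases le_total k M with h | h
  · refine sum_subset (range_mono (by lia)) fun p _ hp => h₁ p ?_
    simpa using hp
  · symm
    refine sum_subset (range_mono (by lia)) fun p _ hp => h₂ p ?_
    simpa using hp

/-- Newton interpolation of a polynomial at the natural numbers, written with Pochhammer
symbols. -/
theorem eval_natCast_eq_sum_poch (P : ℂ[X]) (M : ℕ) (hP : P.natDegree ≤ M) (k : ℕ) :
    P.eval (k : ℂ) = ∑ p ∈ range (M + 1), poch (-(k : ℂ)) p / (p.factorial : ℂ) *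
      ∑ j ∈ range (p + 1), poch (-(p : ℂ)) j / (j.factorial : ℂ) * P.eval (j : ℂ) := by
  have hN := shift_eq_sum_fwdDiff_iter (1 : ℂ) (fun x => P.eval x) k 0
  simp only [zero_add, nsmul_eq_mul, mul_one] at hN
  rw [hN, sum_range_succ_congr_of_zero (M := M)]
  · refine sum_congr rfl fun p _ => ?_
    have h3 : (p.factorial : ℂ) ≠ 0 := by exact_mod_cast p.factorial_ne_zero
    have hsq : ((-1 : ℂ) ^ p) * (-1) ^ p = 1 := by rw [← mul_pow]; simp
    rw [fwdDiff_iter_eq_sum_shift, poch_neg_natCast, mul_sum, mul_sum]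
    refine sum_congr rfl fun j hj => ?_
    obtain ⟨i, rfl⟩ := Nat.exists_eq_add_of_le (Nat.lt_succ_iff.mp (mem_range.mp hj))
    have h4 : (j.factorial : ℂ) ≠ 0 := by exact_mod_cast j.factorial_ne_zero
    have hsj : ((-1 : ℂ) ^ j) * (-1) ^ j = 1 := by rw [← mul_pow]; simp
    rw [poch_neg_natCast, Nat.add_sub_cancel_left, pow_add]
    simp only [zero_add, nsmul_eq_mul, mul_one, zsmul_eq_mul]
    push_cast
    field_simp
    linear_combination (-((k.choose (j + i) : ℂ) * (j + i).choose j * P.eval (j : ℂ))) *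
      hsj
  · intro p hp
    simp [Nat.choose_eq_zero_of_lt hp]
  · intro p hp
    have := congrFun (Polynomial.fwdDiff_iter_eq_zero_of_degree_lt (hP.trans_lt hp)) 0
    simp only [Pi.zero_apply] at this
    rw [this, mul_zero]

/-! ### Products of Pochhammer symbols and terminating series. -/

@[simp] lemma pochs_cons (x : ℂ) (A : Multiset ℂ) (k : ℕ) :
    pochs (x ::ₘ A) k = poch x k * pochs A k := by simp [pochs]

lemma pochs_add (A B : Multiset ℂ) (k : ℕ) : pochs (A + B) k = pochs A k * pochs B k := by
  simp [pochs]

@[simp] lemma pochs_singleton (x : ℂ) (k : ℕ) : pochs {x} k = poch x k := by simp [pochs]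

@[simp] lemma pochs_zero (A : Multiset ℂ) : pochs A 0 = 1 := by simp [pochs]

lemma pochs_entries {r : ℕ} (v : Fin r → ℂ) (k : ℕ) : pochs (entries v) k = ∏ i, poch (v i) k := by
  simp only [pochs, entries, Multiset.map_map]
  rfl

lemma pochs_ne_zero {A : Multiset ℂ} (hA : ∀ x ∈ A, ∀ k : ℕ, x ≠ -k) (k : ℕ) :
    pochs A k ≠ 0 := by
  unfold pochs
  refine Multiset.prod_ne_zero fun h => ?_
  obtain ⟨x, hx, h0⟩ := Multiset.mem_map.mp h
  exact poch_ne_zero (hA x hx) k h0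

/-- The quotient of Pochhammer symbols of parameters with integral differences is a
polynomial. -/
lemma exists_eval_eq_pochs_div {r : ℕ} (f : Fin r → ℂ) (m : Fin r → ℕ)
    (hf : ∀ i, ∀ k : ℕ, f i ≠ -k) : ∃ P : ℂ[X], P.natDegree ≤ ∑ i, m i ∧ ∀ k : ℕ,
      P.eval (k : ℂ) = pochs (entries fun i => f i + m i) k / pochs (entries f) k := by
  -- Splitting `(f)_(m+k)` in two ways gives `(f+m)_k / (f)_k = (f+k)_m / (f)_m`.
  refine ⟨∏ i, C ((poch (f i) (m i))⁻¹) * (ascPochhammer ℂ (m i)).comp (X + C (f i)), ?_, ?_⟩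
  · refine (natDegree_prod_le _ _).trans (sum_le_sum fun i _ => ?_)
    refine natDegree_mul_le.trans ?_
    rw [natDegree_C, zero_add, natDegree_comp, ascPochhammer_natDegree, natDegree_X_add_C, mul_one]
  · intro k
    rw [eval_prod, pochs_entries, pochs_entries, ← prod_div_distrib]
    refine prod_congr rfl fun i _ => ?_
    have h1 := poch_ne_zero (hf i) k
    have h2 := poch_ne_zero (hf i) (m i)
    have h : poch (f i) k * poch (f i + k) (m i) = poch (f i) (m i) * poch (f i + m i) k := by
      rw [← poch_add, ← poch_add, add_comm]
    simp only [eval_mul, eval_C, eval_comp, eval_add, eval_X]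
    rw [show (ascPochhammer ℂ (m i)).eval (k + f i) = poch (f i + k) (m i) by
      rw [add_comm]; rfl]
    field_simp
    linear_combination h

lemma hyperF_neg_natCast (N : ℕ) (A B : Multiset ℂ) :
    hyperF (-(N : ℂ) ::ₘ A) B 1 =
      ∑ k ∈ range (N + 1), poch (-(N : ℂ)) k * pochs A k / (pochs B k * (k.factorial : ℂ)) := by
  unfold hyperF
  rw [tsum_eq_sum (s := range (N + 1))]
  · simp
  · intro j hj
    have hj' : N < j := by simpa using hj
    simp [poch_neg_eq_zero hj']

/-! ### The Miller-Paris transformation. -/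

/-- The second Miller-Paris transformation, as an identity of formal power series. -/
theorem mk_pochs_eq_binSeries_mul {r : ℕ} (f : Fin r → ℂ) (m : Fin r → ℕ) (a b c s : ℂ)
    (hs : s = c - a - b - (∑ i, m i : ℕ)) (h₂ : poch (c - a - (∑ i, m i : ℕ)) (∑ i, m i) ≠ 0)
    (h₃ : poch (c - b - (∑ i, m i : ℕ)) (∑ i, m i) ≠ 0) (hc : ∀ k : ℕ, c ≠ -k)
    (hf : ∀ i, ∀ k : ℕ, f i ≠ -k) :
    PowerSeries.mk (fun k => poch a k * poch b k / (poch c k * (k.factorial : ℂ)) *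
        (pochs (entries fun i => f i + m i) k / pochs (entries f) k)) =
      binSeries (-s) * PowerSeries.mk (fun j =>
        poch (a + s) j * poch (b + s) j / (poch c j * (j.factorial : ℂ)) *
          (Qhat a b c f m).eval (-(j : ℂ))) := by
  obtain ⟨P, hdeg, hP⟩ := exists_eval_eq_pochs_div f m hf
  let S : ℕ → ℂ := fun p => hyperF (-(p : ℂ) ::ₘ entries fun i => f i + m i) (entries f) 1 /
    (p.factorial : ℂ)
  -- The Newton coefficients are the terminating series `F(-p, f+m; f)` over `p!`.
  have hk (k : ℕ) : pochs (entries fun i => f i + m i) k / pochs (entries f) k =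
      ∑ p ∈ range ((∑ i, m i) + 1), S p * poch (-(k : ℂ)) p := by
    rw [← hP, eval_natCast_eq_sum_poch P _ hdeg]
    refine sum_congr rfl fun p _ => ?_
    simp only [S, hyperF_neg_natCast, hP]
    rw [div_mul_comm]
    congr 2
    exact sum_congr rfl fun j _ => by ring
  set M := ∑ i, m i with hM
  have hsum : ∀ p ∈ range (M + 1), _ := fun p hp =>
    congrArg (fun F => PowerSeries.C (S p) * F) (mk_poch_neg_mul_gauss a b c s M p
      (Nat.lt_succ_iff.mp (mem_range.mp hp)) hc hs h₂ h₃)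
  have hsum' := sum_congr rfl hsum
  simp only [mul_left_comm (PowerSeries.C _) (binSeries _)] at hsum'
  rw [← mul_sum] at hsum'
  convert hsum' using 1
  · ext k
    simp only [map_sum, PowerSeries.coeff_C_mul, PowerSeries.coeff_mk, hk, mul_sum]
    exact sum_congr rfl fun p _ => by ring
  · congr 1
    ext j
    simp only [map_sum, PowerSeries.coeff_C_mul, PowerSeries.coeff_mk, Qhat, eval_finsetSum,
      mul_sum]
    refine sum_congr rfl fun p _ => ?_
    rw [eval_mul, eval_mul, eval_C, ← hM, ← hs]
    simp only [S, poch]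
    ring

/-! ### The characteristic polynomial through its zeros. -/

/-- At `t = 0` the factor `(t)_k` kills every `k ≥ 1`, and the `₃F₂` of the term `k = 0` has an
upper parameter `0`. -/
lemma eval_zero_Qhat {r : ℕ} (f : Fin r → ℂ) (m : Fin r → ℕ) (a b c : ℂ) :
    (Qhat a b c f m).eval 0 = 1 := by
  rw [eval_Qhat a b c f m _ rfl, sum_range_succ', sum_eq_zero]
  · have h1 : hyperF (-((0 : ℕ) : ℂ) ::ₘ entries fun i => f i + m i) (entries f) 1 = 1 := by
      rw [hyperF_neg_natCast]
      simp
    have h2 (N : ℕ) (u v w : ℂ) : hyperF {-(N : ℂ) + (0 : ℕ), 0 + ((0 : ℕ) : ℂ), u} {v, w} 1 = 1 := by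
      rw [Nat.cast_zero, add_zero, add_zero, Multiset.insert_eq_cons, hyperF_neg_natCast,
        sum_range_succ', sum_eq_zero]
      · simp
      · intro k _
        simp [poch_succ_left 0]
    rw [h1, h2]
    simp
  · intro k _
    simp [poch_succ_left 0]

lemma pochs_map_add_one (A : Multiset ℂ) (k : ℕ) :
    pochs (A.map fun z => z + 1) k * (A.map fun z => z).prod =
      pochs A k * (A.map fun z => z + (k : ℂ)).prod := by
  induction A using Multiset.induction_on with
  | empty => simp
  | cons z A ih =>
    have hz : poch (z + 1) k * z = poch z k * (z + k) := by
      rw [← poch_succ, poch_succ_left, mul_comm]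
    simp only [Multiset.map_cons, pochs_cons, Multiset.prod_cons]
    linear_combination poch z k * (z + k) * ih + pochs (A.map fun z => z + 1) k *
      (A.map fun z => z).prod * hz

/-- A polynomial with value one at the origin, in terms of its zeros. -/
lemma eval_neg_natCast_eq_pochs_div {Q : ℂ[X]} (hQ : Q.eval 0 = 1)
    (hz : ∀ z ∈ Q.roots, ∀ k : ℕ, z ≠ -k) (k : ℕ) :
    Q.eval (-(k : ℂ)) = pochs (Q.roots.map fun z => z + 1) k / pochs Q.roots k := by
  have hs : Q.Splits := IsAlgClosed.splits Q
  have hev (x : ℂ) := hs.eval_eq_prod_roots x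
  have hneg (x : ℂ) : (Q.roots.map fun z => -x - z).prod =
      (-1) ^ Multiset.card Q.roots * (Q.roots.map fun z => z + x).prod := by
    induction Q.roots using Multiset.induction_on with
    | empty => simp
    | cons z A ih => simp only [Multiset.map_cons, Multiset.prod_cons, ih, Multiset.card_cons]; ring
  -- The value at the origin fixes the leading coefficient; the form `-0` lets `hneg` apply.
  have h0 := hev (-0)
  rw [hneg, neg_zero, hQ] at h0
  have hk := hev (-(k : ℂ))
  rw [hneg] at hk
  have h := pochs_map_add_one Q.roots k
  simp only [add_zero] at h0
  rw [eq_div_iff (pochs_ne_zero hz k), hk]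
  linear_combination (-(Q.leadingCoeff * (-1) ^ Multiset.card Q.roots)) * h -
    pochs (Q.roots.map fun z => z + 1) k * h0

/-! ### Summation against balanced weights. -/

/-- The balance makes `z-x-y` and `z-y` in `saalschutz` equal to `1-E-N` and `1-(E+s)-N`; reversing
those Pochhammer symbols gives this symmetric form. -/
lemma saalschutz_balanced (D G E s : ℂ) (N : ℕ) (h : G + E + N - D + s = 1) :
    ∑ i ∈ range (N + 1), (N.choose i : ℂ) * (-1) ^ i *
      (poch (-s) i * poch D i * poch (G + i) (N - i) * poch (E + i) (N - i)) =
      poch (G + s) N * poch (E + s) N := by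
  have hS := saalschutz (-s) D G N
  rw [show G - -s - D = 1 - E - N by linear_combination h,
    show G - D = 1 - (E + s) - N by linear_combination h, poch_neg, sub_neg_eq_add] at hS
  have hsN : ((-1 : ℂ) ^ N) * (-1) ^ N = 1 := by rw [← mul_pow]; simp
  calc _ = (-1) ^ N * ∑ i ∈ range (N + 1), (N.choose i : ℂ) * (poch (-s) i * poch D i *
          poch (G + i) (N - i) * poch (1 - E - N) (N - i)) := by
        rw [mul_sum]
        refine sum_congr rfl fun i hi => ?_
        obtain ⟨l, rfl⟩ := Nat.exists_eq_add_of_le (Nat.lt_succ_iff.mp (mem_range.mp hi))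
        rw [Nat.add_sub_cancel_left, show 1 - E - ((i + l : ℕ) : ℂ) = 1 - (E + i) - l by
          push_cast; ring, poch_neg, pow_add]
        have hl : ((-1 : ℂ) ^ l) * (-1) ^ l = 1 := by rw [← mul_pow]; simp
        linear_combination (-((i + l).choose i * (-1) ^ i * (poch (-s) i * poch D i *
          poch (G + i) l * poch (E + i) l))) * hl
    _ = _ := by
        rw [hS]
        linear_combination (poch (G + s) N * poch (E + s) N) * hsN

/-- This is the weight functional on `x^j (1-x)^s`. Pulling out the first `j` factors replaces `n,
d, g, e` by `n-j, d+j, g+j, e+j`, which preserves the balance. -/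
lemma sum_binSeries_mul_weight (d g e s : ℂ) (n j : ℕ) (hj : j ≤ n)
    (h : g + e + n - d + s = 1) (hg : ∀ k : ℕ, g ≠ -k) (he : ∀ k : ℕ, e ≠ -k)
    (hgs : ∀ k : ℕ, g + s ≠ -k) (hes : ∀ k : ℕ, e + s ≠ -k) :
    ∑ i ∈ range (n - j + 1), poch (-s) i / (i.factorial : ℂ) *
      (poch (-(n : ℂ)) (j + i) * poch d (j + i) / (poch g (j + i) * poch e (j + i))) =
    poch (g + s) n * poch (e + s) n / (poch g n * poch e n) *
      (poch (-(n : ℂ)) j * poch d j / (poch (g + s) j * poch (e + s) j)) := by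
  obtain ⟨N, rfl⟩ := Nat.exists_eq_add_of_le hj
  rw [Nat.add_sub_cancel_left]
  have hS := saalschutz_balanced (d + j) (g + j) (e + j) s N (by
    push_cast at h; linear_combination h)
  have g1 := poch_ne_zero hg j
  have e1 := poch_ne_zero he j
  have g2 := poch_add_natCast_ne_zero hg j N
  have e2 := poch_add_natCast_ne_zero he j N
  have gs := poch_ne_zero hgs j
  have es := poch_ne_zero hes j
  rw [poch_add g, poch_add e, poch_add (g + s), poch_add (e + s)]
  rw [show g + j + s = g + s + j by ring, show e + j + s = e + s + j by ring] at hS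
  calc _ = poch (-((j + N : ℕ) : ℂ)) j * poch d j / (poch g j * poch e j *
        (poch (g + j) N * poch (e + j) N)) * ∑ i ∈ range (N + 1), (N.choose i : ℂ) * (-1) ^ i *
      (poch (-s) i * poch (d + j) i * poch (g + j + i) (N - i) * poch (e + j + i) (N - i)) := by
        rw [mul_sum]
        refine sum_congr rfl fun i hi => ?_
        obtain ⟨l, rfl⟩ := Nat.exists_eq_add_of_le (Nat.lt_succ_iff.mp (mem_range.mp hi))
        rw [Nat.add_sub_cancel_left, poch_add _ j i, poch_add d, poch_add g, poch_add e,
          poch_add (g + j), poch_add (e + j),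
          show -((j + (i + l) : ℕ) : ℂ) + j = -((i + l : ℕ) : ℂ) by push_cast; ring,
          poch_neg_natCast (i + l) i]
        rw [poch_add (g + j)] at g2
        rw [poch_add (e + j)] at e2
        have g3 := left_ne_zero_of_mul g2
        have g4 := right_ne_zero_of_mul g2
        have e3 := left_ne_zero_of_mul e2
        have e4 := right_ne_zero_of_mul e2
        have h3 : (i.factorial : ℂ) ≠ 0 := by exact_mod_cast i.factorial_ne_zero
        field_simp
    _ = _ := by
        rw [hS]
        field_simp

/-- Summation of the coefficients of `(1 - x) ^ s β(x)` against balanced weights. -/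
lemma sum_weight_mul_coeff (α β : ℕ → ℂ) (d g e s : ℂ) (n : ℕ)
    (h : g + e + n - d + s = 1) (hg : ∀ k : ℕ, g ≠ -k) (he : ∀ k : ℕ, e ≠ -k)
    (hgs : ∀ k : ℕ, g + s ≠ -k) (hes : ∀ k : ℕ, e + s ≠ -k)
    (hαβ : PowerSeries.mk α = binSeries (-s) * PowerSeries.mk β) :
    ∑ k ∈ range (n + 1), α k * (poch (-(n : ℂ)) k * poch d k / (poch g k * poch e k)) =
      poch (g + s) n * poch (e + s) n / (poch g n * poch e n) *
        ∑ j ∈ range (n + 1), β j *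
          (poch (-(n : ℂ)) j * poch d j / (poch (g + s) j * poch (e + s) j)) := by
  have hα (k : ℕ) : α k = ∑ j ∈ range (k + 1), β j * (poch (-s) (k - j) / ((k - j).factorial : ℂ)) := by
    have := congrArg (PowerSeries.coeff k) hαβ
    rw [mul_comm, PowerSeries.coeff_mul, Finset.Nat.sum_antidiagonal_eq_sum_range_succ_mk] at this
    simpa [coeff_binSeries] using this
  simp_rw [hα, sum_mul]
  rw [sum_sigma', mul_sum]
  have hr : ∀ j ∈ range (n + 1), poch (g + s) n * poch (e + s) n / (poch g n * poch e n) *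
      (β j * (poch (-(n : ℂ)) j * poch d j / (poch (g + s) j * poch (e + s) j))) =
      ∑ i ∈ range (n - j + 1), β j * (poch (-s) i / (i.factorial : ℂ) *
        (poch (-(n : ℂ)) (j + i) * poch d (j + i) / (poch g (j + i) * poch e (j + i)))) := by
    intro j hj
    rw [mul_left_comm, ← sum_binSeries_mul_weight d g e s n j
      (Nat.lt_succ_iff.mp (mem_range.mp hj)) h hg he hgs hes, mul_sum]
  rw [sum_congr rfl hr, sum_sigma']
  refine sum_bij' (fun x _ => ⟨x.2, x.1 - x.2⟩) (fun x _ => ⟨x.1 + x.2, x.1⟩) ?_ ?_ ?_ ?_ ?_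
  · simp; lia
  · simp; lia
  · rintro ⟨k, j⟩ hx
    simp at hx ⊢; lia
  · rintro ⟨k, j⟩ hx
    simp
  · rintro ⟨k, j⟩ hx
    simp at hx
    rw [show j + (k - j) = k by lia]
    ring

lemma sum_entries_add_natCast {r : ℕ} (f : Fin r → ℂ) (m : Fin r → ℕ) :
    (entries fun i => f i + m i).sum = (entries f).sum + (∑ i, m i : ℕ) := by
  simp only [entries]
  change ∑ i, (f i + m i) = ∑ i, f i + _
  rw [sum_add_distrib]
  push_cast
  rfl

end

/-! ### The transformation of Saalschützian series. -/

theorem theorem2 (r : ℕ) (f : Fin r → ℂ) (m : Fin r → ℕ) (M : ℕ) (hM : M = ∑ i, m i)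
    (a b c d e g lam : ℂ) (n : ℕ) (zeta : Multiset ℂ)
    (hlam : lam = c - a - b - M)
    (hzeta : zeta = (Qhat a b c f m).roots)
    (h₁ : poch (1 + a + b - c) M ≠ 0)
    (h₂ : poch (c - a - M) M ≠ 0)
    (h₃ : poch (c - b - M) M ≠ 0)
    (hbal : g + e + n - d + lam = 1)
    -- the lower parameters are not non-positive integers
    (hc : ∀ k : ℕ, c ≠ -k) (hg : ∀ k : ℕ, g ≠ -k) (he : ∀ k : ℕ, e ≠ -k)
    (hf : ∀ i, ∀ k : ℕ, f i ≠ -k)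
    (hglam : ∀ k : ℕ, g + lam ≠ -k) (helam : ∀ k : ℕ, e + lam ≠ -k)
    (hz : ∀ z ∈ zeta, ∀ k : ℕ, z ≠ -k) :
    hyperF ({-(n : ℂ), a, b, d} + entries fun i => f i + m i) ({c, g, e} + entries f) 1 =
        poch (g + lam) n * poch (e + lam) n / (poch g n * poch e n) *
          hyperF ({-(n : ℂ), a + lam, b + lam, d} + zeta.map fun z => z + 1)
            ({c, g + lam, e + lam} + zeta) 1 ∧
      IsSaalschutzian ({-(n : ℂ), a, b, d} + entries fun i => f i + m i)
        ({c, g, e} + entries f) ∧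
      (Multiset.card zeta = M →
        IsSaalschutzian ({-(n : ℂ), a + lam, b + lam, d} + zeta.map fun z => z + 1)
          ({c, g + lam, e + lam} + zeta)) := by
  subst hM
  refine ⟨?_, ⟨?_, ?_⟩, fun hcard => ⟨?_, ?_⟩⟩
  · subst hzeta
    have key := sum_weight_mul_coeff _ _ d g e lam n hbal hg he hglam helam
      (mk_pochs_eq_binSeries_mul f m a b c lam hlam h₂ h₃ hc hf)
    simp only [Multiset.insert_eq_cons, Multiset.cons_add, hyperF_neg_natCast]
    simp only [pochs_cons, pochs_add, pochs_singleton]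
    refine Eq.trans (Finset.sum_congr rfl fun k _ => ?_)
      (key.trans (congrArg _ (Finset.sum_congr rfl fun k _ => ?_)))
    · ring
    · rw [eval_neg_natCast_eq_pochs_div (eval_zero_Qhat f m a b c) hz]
      ring
  · simp [entries]
  · simp only [parametricExcess, Multiset.sum_add, sum_entries_add_natCast]
    simp only [Multiset.insert_eq_cons, Multiset.sum_cons, Multiset.sum_singleton]
    linear_combination hbal - hlam
  · simp
  · have hsum : (zeta.map fun z => z + 1).sum = zeta.sum + (∑ i, m i : ℕ) := by
      rw [Multiset.sum_map_add, ← hcard]; simp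
    simp only [parametricExcess, Multiset.sum_add, hsum]
    simp only [Multiset.insert_eq_cons, Multiset.sum_cons, Multiset.sum_singleton]
    linear_combination hbal - hlam
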